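/- For probability measures $P,Q$ on the same measurable space and $\alpha\in[0,1]$, let $T(P,Q)(\alpha)=\inf\{1-\int\varphi\,dQ:\ \varphi \text{ a measurable } [0,1]\text{-valued test with } \int\varphi\,dP\le\alpha\}$ be the trade-off function, and for $t\ge 0$, $c\in[0,1]$ let $\alpha_{P,Q}(t,c)=P\big[\tfrac{dQ}{dP}>t\big]+c\,P\big[\tfrac{dQ}{dP}=t\big]$ be the type I error of the likelihood ratio test. Let $n,N\ge 1$ be integers, $0<q\le 1$, $\sigma>0$, $C>0$, let $g_1,\dots,g_N,g_{N+1}\in\mathbb R^n$, and let $\bar g_i=g_i/\max(1,\|g_i\|_2/C)$. Let $G\sim\mathcal N(0,\sigma^2C^2 I_n)$. For $B\subseteq\{1,\dots,N\}$ put $P(B)=q^{|B|}(1-q)^{N-|B|}$ and let $$P_B=\mathrm{Law}\Big(\tfrac{\sum_{i\in B}\bar g_i+G}{Nq}\Big),\quad Q_B^1=\mathrm{Law}\Big(\tfrac{\sum_{i\in B}\bar g_i+G}{(N+1)q}\Big),\quad Q_B^2=\mathrm{Law}\Big(\tfrac{\sum_{i\in B}\bar g_i+\bar g_{N+1}+G}{(N+1)q}\Big).$$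 These are the output distributions of the Expected-Averaged Subsampled Gaussian Mechanism (EASGM) on the neighboring datasets $D=(g_1,\dots,g_N)$ and $D'=(g_1,\dots,g_{N+1})$, given the sampled batch. Let $f_B^j=T(P_B,Q_B^j)$, $\alpha_B^j(t,c)=\alpha_{P_B,Q_B^j}(t,c)$ and $\alpha(t,c)=\sum_B P(B)\big((1-q)\alpha_B^1(t,c)+q\,\alpha_B^2(t,c)\big)$. Let $f$ be the per-pair EASGM guarantee, that is, the trade-off function $f=T\big((P_I\mid I,I),(Q_I\mid I,I)\big)$ between the joint laws of output and sampling outcome $I$ under $D$ and $D'$: $I=(B,j)$ has probability $P(B)(1-q)$ if $j=1$ and $P(B)q$ if $j=2$, and given $I=(B,j)$ the output has law $P_B$ under $D$ and $Q_B^j$ under $D'$. Then for all $t\ge0$, $c\in[0,1]$, $$f(\alpha(t,c))=\sum_B P(B)\big((1-q)f_B^1(\alpha_B^1(t,c))+q\,f_B^2(\alpha_B^2(t,c))\big),$$ and, with $P=\mathcal N(0,1)$ and $Q_N=\mathcal N\big(0,(\tfrac{N}{N+1})^2\big)$, $$f(\alpha)\le\overline f(\alpha):=T\big(P^{\otimes(n-1)},Q_N^{\otimes(n-1)}\big)(\alpha)\qquad\text{for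 every }\alpha\in[0,1].$$ -/

import Mathlib

open MeasureTheory ProbabilityTheory
open scoped NNReal ENNReal

namespace EASGM

/-- The trade-off function of the pair `(P, Q)` at level `α`: the least type II error
`1 - ∫ φ dQ` among the (possibly randomized) tests `φ` of `P` against `Q` whose type I error
`∫ φ dP` is at most `α`; `φ y` is the probability of rejecting `P` when `y` is observed. -/
noncomputable def tradeOff {Y : Type*} [MeasurableSpace Y] (P Q : Measure Y) (α : ℝ) : ℝ :=
  sInf {β : ℝ | ∃ φ : Y → ℝ, Measurable φ ∧ (∀ y, φ y ∈ Set.Icc (0 : ℝ) 1) ∧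
    ∫ y, φ y ∂P ≤ α ∧ β = ∫ y, (1 - φ y) ∂Q}

/-- The type I error of the likelihood ratio test of `P` against `Q` with threshold `t`, which
rejects with probability `c` on the boundary:
`P[dQ/dP > t] + c * P[dQ/dP = t]`. -/
noncomputable def lrTypeI {Y : Type*} [MeasurableSpace Y] (P Q : Measure Y) (t c : ℝ) : ℝ :=
  P.real {y | ENNReal.ofReal t < Q.rnDeriv P y} +
    c * P.real {y | Q.rnDeriv P y = ENNReal.ofReal t}

/-- The joint law of `(I, X)`, where `I = i` with probability `w i`, and `X` has law `P i` given
`I = i`. -/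
noncomputable def labelledMixture {ι Y : Type*} [Fintype ι] [MeasurableSpace ι]
    [MeasurableSpace Y] (w : ι → ℝ) (P : ι → Measure Y) : Measure (ι × Y) :=
  ∑ i, ENNReal.ofReal (w i) • (Measure.dirac i).prod (P i)

/-- Clipping of a vector to norm at most `C`. -/
noncomputable def clip {n : ℕ} (C : ℝ) (g : EuclideanSpace ℝ (Fin n)) :
    EuclideanSpace ℝ (Fin n) :=
  (max 1 (‖g‖ / C))⁻¹ • g

/-- The law of `(s + G) / m`, where `G` is Gaussian with law `N(0, σ² C² I)` on `ℝⁿ`. -/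
noncomputable def noisyAverage {n : ℕ} (σ C : ℝ) (s : EuclideanSpace ℝ (Fin n)) (m : ℝ) :
    Measure (EuclideanSpace ℝ (Fin n)) :=
  (multivariateGaussian 0 ((σ ^ 2 * C ^ 2) • (1 : Matrix (Fin n) (Fin n) ℝ))).map
    fun x => m⁻¹ • (s + x)

/-- The probability that Poisson sampling with rate `q` from `N` records draws the batch `B`. -/
noncomputable def batchProb {N : ℕ} (q : ℝ) (B : Finset (Fin N)) : ℝ :=
  q ^ B.card * (1 - q) ^ (N - B.card)

/-- The output of the mechanism on the `N` records `g`, given that `B` is sampled. -/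
noncomputable def outD {n N : ℕ} (q σ C : ℝ) (g : Fin N → EuclideanSpace ℝ (Fin n))
    (B : Finset (Fin N)) : Measure (EuclideanSpace ℝ (Fin n)) :=
  noisyAverage σ C (∑ i ∈ B, clip C (g i)) (N * q)

/-- The output of the mechanism on the `N + 1` records `g, g'`, given that `B` is sampled from the
first `N` records and the record `g'` is not sampled. -/
noncomputable def outD'₁ {n N : ℕ} (q σ C : ℝ) (g : Fin N → EuclideanSpace ℝ (Fin n))
    (B : Finset (Fin N)) : Measure (EuclideanSpace ℝ (Fin n)) :=
  noisyAverage σ C (∑ i ∈ B, clip C (g i)) ((N + 1) * q)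

/-- The output of the mechanism on the `N + 1` records `g, g'`, given that `B` is sampled from the
first `N` records and the record `g'` is sampled as well. -/
noncomputable def outD'₂ {n N : ℕ} (q σ C : ℝ) (g : Fin N → EuclideanSpace ℝ (Fin n))
    (g' : EuclideanSpace ℝ (Fin n)) (B : Finset (Fin N)) :
    Measure (EuclideanSpace ℝ (Fin n)) :=
  noisyAverage σ C (∑ i ∈ B, clip C (g i) + clip C g') ((N + 1) * q)

/-- The per-pair guarantee: the trade-off function of the outputs on `D = g` and `D' = g, g'` when
the sampling outcome `I` is revealed together with the output. Here `I = (B, b)`, where `B` is the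
batch sampled from the first `N` records and `b` tells whether the last record is sampled. -/
noncomputable def guarantee {n N : ℕ} (q σ C : ℝ) (g : Fin N → EuclideanSpace ℝ (Fin n))
    (g' : EuclideanSpace ℝ (Fin n)) : ℝ → ℝ :=
  let w : Finset (Fin N) × Bool → ℝ := fun I => batchProb q I.1 * if I.2 then q else 1 - q
  tradeOff (labelledMixture w fun I => outD q σ C g I.1)
    (labelledMixture w fun I => if I.2 then outD'₂ q σ C g g' I.1 else outD'₁ q σ C g I.1)

/-- The overall type I error `α(t, c)` of the likelihood ratio tests with parameters `(t, c)`. -/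
noncomputable def totalTypeI {n N : ℕ} (q σ C : ℝ) (g : Fin N → EuclideanSpace ℝ (Fin n))
    (g' : EuclideanSpace ℝ (Fin n)) (t c : ℝ) : ℝ :=
  ∑ B : Finset (Fin N), batchProb q B *
    ((1 - q) * lrTypeI (outD q σ C g B) (outD'₁ q σ C g B) t c +
      q * lrTypeI (outD q σ C g B) (outD'₂ q σ C g g' B) t c)

/-- The mixture `∑_B P(B) ((1 - q) f_B¹(α_B¹(t, c)) + q f_B²(α_B²(t, c)))`. -/
noncomputable def totalTypeII {n N : ℕ} (q σ C : ℝ) (g : Fin N → EuclideanSpace ℝ (Fin n))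
    (g' : EuclideanSpace ℝ (Fin n)) (t c : ℝ) : ℝ :=
  ∑ B : Finset (Fin N), batchProb q B *
    ((1 - q) * tradeOff (outD q σ C g B) (outD'₁ q σ C g B)
        (lrTypeI (outD q σ C g B) (outD'₁ q σ C g B) t c) +
      q * tradeOff (outD q σ C g B) (outD'₂ q σ C g g' B)
        (lrTypeI (outD q σ C g B) (outD'₂ q σ C g g' B) t c))

/-- The `k`-fold product of the standard normal distribution `P = N(0, 1)`. -/
noncomputable def stdNormalPow (k : ℕ) : Measure (Fin k → ℝ) :=
  Measure.pi fun _ => gaussianReal 0 1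

/-- The `k`-fold product of `Q_N = N(0, (N / (N + 1))²)`. -/
noncomputable def shrunkNormalPow (N k : ℕ) : Measure (Fin k → ℝ) :=
  Measure.pi fun _ => gaussianReal 0 (((N : ℝ≥0) / ((N : ℝ≥0) + 1)) ^ 2)

/-- The upper bound `T(P^{⊗(n-1)}, Q_N^{⊗(n-1)})`. -/
noncomputable def upperBound (n N : ℕ) : ℝ → ℝ :=
  tradeOff (stdNormalPow (n - 1)) (shrunkNormalPow N (n - 1))

end EASGM

namespace EASGM

/-! ### Neyman–Pearson tests and trade-off functions of labelled mixtures -/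

section General

variable {ι Y Z : Type*} [MeasurableSpace Y] [MeasurableSpace Z]

/-! Since the label is revealed, a test on the joint law is a free choice of one test per label, and
both of its errors are averages with weights `w`.

Equality: for each label, the likelihood ratio test with threshold `t` minimizes type II error plus
`t` times type I error (`neyman_pearson`, which needs `Q ≪ P`). A common `t` makes the average of
these tests minimize the averaged objective, so no test of at most the same total type I error has
smaller type II error (`tradeOff_labelledMixture`).

Upper bound: for each label the two outputs are isotropic Gaussians whose scales have ratio `N / (N
+ 1)`. Projecting orthogonally to the difference of the means, then centering and rescaling, yields
the same pair in dimension `n - 1` whatever the label (`exists_map_noisyAverage_eq`). Hence any test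
of that pair pulls back to a test of the joint laws with the same errors
(`tradeOff_labelledMixture_le`). -/

lemma integrable_of_mem_Icc {P : Measure Y} [IsFiniteMeasure P] {φ : Y → ℝ} (hφ : Measurable φ)
    (h : ∀ y, φ y ∈ Set.Icc (0 : ℝ) 1) : Integrable φ P :=
  Integrable.of_mem_Icc 0 1 hφ.aemeasurable (ae_of_all _ h)

/-- The trade-off function takes the value of any optimal test. -/
lemma tradeOff_eq {P Q : Measure Y} {ψ : Y → ℝ} (hψ : Measurable ψ)
    (hψ1 : ∀ y, ψ y ∈ Set.Icc (0 : ℝ) 1)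
    (h : ∀ φ : Y → ℝ, Measurable φ → (∀ y, φ y ∈ Set.Icc (0 : ℝ) 1) →
      ∫ y, φ y ∂P ≤ ∫ y, ψ y ∂P → ∫ y, (1 - ψ y) ∂Q ≤ ∫ y, (1 - φ y) ∂Q) :
    tradeOff P Q (∫ y, ψ y ∂P) = ∫ y, (1 - ψ y) ∂Q := by
  refine IsLeast.csInf_eq ⟨⟨ψ, hψ, hψ1, le_rfl, rfl⟩, ?_⟩
  rintro _ ⟨φ, hφ, hφ1, hle, rfl⟩
  exact h φ hφ hφ1 hle

/-- The likelihood ratio test of `P` against `Q` with threshold `t`, which rejects with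
probability `c` on the boundary. -/
noncomputable def lrTest (P Q : Measure Y) (t c : ℝ) (y : Y) : ℝ :=
  {y | ENNReal.ofReal t < Q.rnDeriv P y}.indicator (fun _ => 1) y +
    {y | Q.rnDeriv P y = ENNReal.ofReal t}.indicator (fun _ => c) y

lemma measurableSet_lt_rnDeriv (P Q : Measure Y) (t : ℝ) :
    MeasurableSet {y | ENNReal.ofReal t < Q.rnDeriv P y} :=
  measurableSet_lt measurable_const (Measure.measurable_rnDeriv _ _)

lemma measurableSet_rnDeriv_eq (P Q : Measure Y) (t : ℝ) :
    MeasurableSet {y | Q.rnDeriv P y = ENNReal.ofReal t} :=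
  measurableSet_eq_fun (Measure.measurable_rnDeriv _ _) measurable_const

@[fun_prop]
lemma measurable_lrTest (P Q : Measure Y) (t c : ℝ) : Measurable (lrTest P Q t c) :=
  (measurable_const.indicator (measurableSet_lt_rnDeriv P Q t)).add
    (measurable_const.indicator (measurableSet_rnDeriv_eq P Q t))

lemma lrTest_mem_Icc (P Q : Measure Y) (t : ℝ) {c : ℝ} (hc : c ∈ Set.Icc (0 : ℝ) 1) (y : Y) :
    lrTest P Q t c y ∈ Set.Icc (0 : ℝ) 1 := by
  obtain ⟨h0, h1⟩ := hc
  rcases lt_trichotomy (ENNReal.ofReal t) (Q.rnDeriv P y) with h | h | h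
  · simp [lrTest, h, h.ne']
  · simp [lrTest, ← h, h0, h1]
  · simp [lrTest, h.le, h.ne]

lemma integral_lrTest (P Q : Measure Y) [IsFiniteMeasure P] (t c : ℝ) :
    ∫ y, lrTest P Q t c y ∂P = lrTypeI P Q t c := by
  have h1 := measurableSet_lt_rnDeriv P Q t
  have h2 := measurableSet_rnDeriv_eq P Q t
  simp only [lrTest, lrTypeI]
  rw [integral_add ((integrable_const _).indicator h1) ((integrable_const _).indicator h2),
    integral_indicator_const _ h1, integral_indicator_const _ h2]
  simp [mul_comm]

/-- The Neyman-Pearson lemma in Lagrangian form: the likelihood ratio test with threshold `t`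
minimizes the type II error plus `t` times the type I error. -/
lemma neyman_pearson {P Q : Measure Y} [IsFiniteMeasure P] [IsFiniteMeasure Q] (hQP : Q ≪ P)
    {t c : ℝ} (ht : 0 ≤ t) (hc : c ∈ Set.Icc (0 : ℝ) 1) {φ : Y → ℝ} (hφ : Measurable φ)
    (hφ1 : ∀ y, φ y ∈ Set.Icc (0 : ℝ) 1) :
    ∫ y, (1 - lrTest P Q t c y) ∂Q + t * lrTypeI P Q t c ≤
      ∫ y, (1 - φ y) ∂Q + t * ∫ y, φ y ∂P := by
  have hψ := measurable_lrTest P Q t c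
  have hψ1 := lrTest_mem_Icc P Q t hc
  rw [← integral_lrTest, ← integral_rnDeriv_smul hQP, ← integral_rnDeriv_smul hQP,
    ← integral_const_mul, ← integral_const_mul]
  have key : ∀ χ : Y → ℝ, Measurable χ → (∀ y, χ y ∈ Set.Icc (0 : ℝ) 1) →
      Integrable (fun y => (Q.rnDeriv P y).toReal • (1 - χ y)) P ∧
        Integrable (fun y => t * χ y) P := fun χ hχ hχ1 =>
    ⟨(integrable_rnDeriv_smul_iff hQP).2 ((integrable_const _).sub (integrable_of_mem_Icc hχ hχ1)),
      (integrable_of_mem_Icc hχ hχ1).const_mul t⟩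
  obtain ⟨a1, a2⟩ := key _ hψ hψ1
  obtain ⟨b1, b2⟩ := key _ hφ hφ1
  rw [← integral_add a1 a2, ← integral_add b1 b2]
  refine integral_mono_ae (a1.add a2) (b1.add b2) ?_
  -- With `r = dQ/dP`, the integrand is `r + (t - r) * χ`: smallest at `χ = 1` where `r > t`, at `χ
  -- = 0` where `r < t`, and independent of `χ` where `r = t`.
  filter_upwards [Measure.rnDeriv_ne_top Q P] with y hy
  obtain ⟨h0, h1⟩ := hφ1 y
  simp only [smul_eq_mul]
  rcases lt_trichotomy (ENNReal.ofReal t) (Q.rnDeriv P y) with h | h | h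
  · have e : lrTest P Q t c y = 1 := by simp [lrTest, h, h.ne']
    have := (ENNReal.ofReal_lt_iff_lt_toReal ht hy).1 h
    rw [e]; nlinarith
  · rw [← h, ENNReal.toReal_ofReal ht]; linarith
  · have e : lrTest P Q t c y = 0 := by simp [lrTest, h.le, h.ne]
    have := (ENNReal.lt_ofReal_iff_toReal_lt hy).1 h
    rw [e]; nlinarith

lemma tradeOff_lrTypeI {P Q : Measure Y} [IsFiniteMeasure P] [IsFiniteMeasure Q] (hQP : Q ≪ P)
    {t c : ℝ} (ht : 0 ≤ t) (hc : c ∈ Set.Icc (0 : ℝ) 1) :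
    tradeOff P Q (lrTypeI P Q t c) = ∫ y, (1 - lrTest P Q t c y) ∂Q := by
  rw [← integral_lrTest]
  refine tradeOff_eq (measurable_lrTest P Q t c) (lrTest_mem_Icc P Q t hc) fun φ hφ hφ1 hle => ?_
  have := neyman_pearson hQP ht hc hφ hφ1
  rw [← integral_lrTest] at this
  nlinarith [mul_le_mul_of_nonneg_left hle ht]

variable [Fintype ι] [MeasurableSpace ι]

lemma integral_labelledMixture {w : ι → ℝ} (hw : ∀ i, 0 ≤ w i) (P : ι → Measure Y)
    [∀ i, IsFiniteMeasure (P i)] {φ : ι × Y → ℝ} (hφ : Measurable φ)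
    (hφ1 : ∀ x, φ x ∈ Set.Icc (0 : ℝ) 1) :
    ∫ x, φ x ∂labelledMixture w P = ∑ i, w i * ∫ y, φ (i, y) ∂P i := by
  unfold labelledMixture
  rw [integral_finsetSum_measure]
  · refine Finset.sum_congr rfl fun i _ => ?_
    rw [integral_smul_measure, ENNReal.toReal_ofReal (hw i), Measure.dirac_prod,
      integral_map (by fun_prop) hφ.aestronglyMeasurable, smul_eq_mul]
  · exact fun i _ => (integrable_of_mem_Icc hφ hφ1).smul_measure ENNReal.ofReal_ne_top

lemma integral_one_sub_labelledMixture {w : ι → ℝ} (hw : ∀ i, 0 ≤ w i) (P : ι → Measure Y)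
    [∀ i, IsFiniteMeasure (P i)] {φ : ι × Y → ℝ} (hφ : Measurable φ)
    (hφ1 : ∀ x, φ x ∈ Set.Icc (0 : ℝ) 1) :
    ∫ x, (1 - φ x) ∂labelledMixture w P = ∑ i, w i * ∫ y, (1 - φ (i, y)) ∂P i :=
  integral_labelledMixture hw P (φ := fun x => 1 - φ x) (measurable_const.sub hφ) fun x =>
    ⟨sub_nonneg.2 (hφ1 x).2, sub_le_self _ (hφ1 x).1⟩

variable [MeasurableSingletonClass ι]

/-- When the labels are revealed, likelihood ratio tests with a common threshold are jointly
optimal. -/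
theorem tradeOff_labelledMixture {w : ι → ℝ} (hw : ∀ i, 0 ≤ w i) {P Q : ι → Measure Y}
    [∀ i, IsFiniteMeasure (P i)] [∀ i, IsFiniteMeasure (Q i)] (hQP : ∀ i, Q i ≪ P i)
    {t c : ℝ} (ht : 0 ≤ t) (hc : c ∈ Set.Icc (0 : ℝ) 1) :
    tradeOff (labelledMixture w P) (labelledMixture w Q)
        (∑ i, w i * lrTypeI (P i) (Q i) t c) =
      ∑ i, w i * tradeOff (P i) (Q i) (lrTypeI (P i) (Q i) t c) := by
  set ψ : ι × Y → ℝ := fun x => lrTest (P x.1) (Q x.1) t c x.2 with hψdef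
  have hψ : Measurable ψ := measurable_from_prod_countable_right fun i => by
    simpa [hψdef] using measurable_lrTest (P i) (Q i) t c
  have hψ1 : ∀ x, ψ x ∈ Set.Icc (0 : ℝ) 1 := fun x => lrTest_mem_Icc _ _ t hc _
  have e1 : ∫ x, ψ x ∂labelledMixture w P = ∑ i, w i * lrTypeI (P i) (Q i) t c := by
    rw [integral_labelledMixture hw P hψ hψ1]
    simp only [hψdef, integral_lrTest]
  have e2 : ∫ x, (1 - ψ x) ∂labelledMixture w Q =
      ∑ i, w i * tradeOff (P i) (Q i) (lrTypeI (P i) (Q i) t c) := by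
    rw [integral_one_sub_labelledMixture hw Q hψ hψ1]
    simp only [tradeOff_lrTypeI (hQP _) ht hc, hψdef]
  rw [← e1, ← e2]
  refine tradeOff_eq hψ hψ1 fun φ hφ hφ1 hle => ?_
  have h : ∑ i, w i * (∫ y, (1 - lrTest (P i) (Q i) t c y) ∂Q i + t * lrTypeI (P i) (Q i) t c) ≤
      ∑ i, w i * (∫ y, (1 - φ (i, y)) ∂Q i + t * ∫ y, φ (i, y) ∂P i) :=
    Finset.sum_le_sum fun i _ => mul_le_mul_of_nonneg_left
      (neyman_pearson (hQP i) ht hc (hφ.comp measurable_prodMk_left) fun y => hφ1 (i, y)) (hw i)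
  -- Having the same `t` for all labels lets it factor out, leaving the total type I errors.
  simp only [mul_add, Finset.sum_add_distrib, mul_left_comm _ t, ← Finset.mul_sum] at h
  rw [e1, integral_labelledMixture hw P hφ hφ1] at hle
  rw [integral_one_sub_labelledMixture hw Q hψ hψ1, integral_one_sub_labelledMixture hw Q hφ hφ1]
  have := mul_le_mul_of_nonneg_left hle ht
  simp only [hψdef]
  linarith

/-- If every pair `(P i, Q i)` can be processed into the same pair `(P₀, Q₀)`, then the labelled
mixtures are at least as distinguishable as `P₀` and `Q₀`. -/
theorem tradeOff_labelledMixture_le {w : ι → ℝ} (hw : ∀ i, 0 ≤ w i) (hw1 : ∑ i, w i = 1)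
    {P Q : ι → Measure Y} [∀ i, IsFiniteMeasure (P i)] [∀ i, IsFiniteMeasure (Q i)]
    {P₀ Q₀ : Measure Z} {T : ι → Y → Z} (hT : ∀ i, Measurable (T i))
    (hP : ∀ i, (P i).map (T i) = P₀) (hQ : ∀ i, (Q i).map (T i) = Q₀) {α : ℝ} (hα : 0 ≤ α) :
    tradeOff (labelledMixture w P) (labelledMixture w Q) α ≤ tradeOff P₀ Q₀ α := by
  -- The zero test, admissible because `0 ≤ α`, shows that the right-hand infimum is over a nonempty
  -- set.
  refine csInf_le_csInf ⟨0, ?_⟩ ⟨_, 0, measurable_const, by simp, by simpa using hα, rfl⟩ ?_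
  · rintro _ ⟨φ, -, hφ1, -, rfl⟩
    exact integral_nonneg fun x => sub_nonneg.2 (hφ1 x).2
  · rintro _ ⟨φ, hφ, hφ1, hle, rfl⟩
    have hm : Measurable fun x : ι × Y => φ (T x.1 x.2) :=
      measurable_from_prod_countable_right fun i => hφ.comp (hT i)
    refine ⟨fun x => φ (T x.1 x.2), hm, fun x => hφ1 _, ?_, ?_⟩
    · rw [integral_labelledMixture hw P hm fun x => hφ1 _]
      have : ∀ i, ∫ y, φ (T i y) ∂P i = ∫ z, φ z ∂P₀ := fun i => by
        rw [← hP i, integral_map (hT i).aemeasurable hφ.aestronglyMeasurable]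
      simpa [this, ← Finset.sum_mul, hw1] using hle
    · rw [integral_one_sub_labelledMixture hw Q hm fun x => hφ1 _]
      have : ∀ i, ∫ y, (1 - φ (T i y)) ∂Q i = ∫ z, (1 - φ z) ∂Q₀ := fun i => by
        rw [← hQ i, integral_map (hT i).aemeasurable
          (hφ.const_sub 1).aestronglyMeasurable]
      simp [this, ← Finset.sum_mul, hw1]

end General

lemma pi_absolutelyContinuous {X : Type*} [MeasurableSpace X] {n : ℕ} {μ ν : Fin n → Measure X}
    [∀ i, SigmaFinite (μ i)] [∀ i, SigmaFinite (ν i)] (h : ∀ i, μ i ≪ ν i) :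
    Measure.pi μ ≪ Measure.pi ν := by
  induction n with
  | zero => rw [Measure.pi_of_empty, Measure.pi_of_empty]
  | succ n ih =>
    rw [← (measurePreserving_piFinSuccAbove μ 0).symm.map_eq,
      ← (measurePreserving_piFinSuccAbove ν 0).symm.map_eq]
    exact ((h 0).prod (ih fun i => h _)).map (MeasurableEquiv.measurable _)

/-! ### Gaussian outputs and their projections -/

section Gaussian

variable {n : ℕ}

lemma stdGaussian_absolutelyContinuous :
    stdGaussian (EuclideanSpace ℝ (Fin n)) ≪ volume := by
  rw [← map_pi_eq_stdGaussian, ← (PiLp.volume_preserving_toLp (Fin n)).map_eq]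
  exact (pi_absolutelyContinuous fun _ =>
    gaussianReal_absolutelyContinuous 0 one_ne_zero).map (by fun_prop)

lemma volume_absolutelyContinuous_stdGaussian :
    volume ≪ stdGaussian (EuclideanSpace ℝ (Fin n)) := by
  rw [← map_pi_eq_stdGaussian, ← (PiLp.volume_preserving_toLp (Fin n)).map_eq]
  exact (pi_absolutelyContinuous fun _ =>
    gaussianReal_absolutelyContinuous' 0 one_ne_zero).map (by fun_prop)

/-- Both characteristic functions are `exp (-a² ‖t‖² / 2)`. -/
lemma multivariateGaussian_smul_one {a : ℝ} :
    multivariateGaussian 0 (a ^ 2 • (1 : Matrix (Fin n) (Fin n) ℝ)) =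
      (stdGaussian (EuclideanSpace ℝ (Fin n))).map fun x => a • x := by
  apply Measure.ext_of_charFun
  ext t
  rw [charFun_multivariateGaussian (Matrix.PosSemidef.one.smul (sq_nonneg a)), charFun_map_smul,
    charFun_stdGaussian, ← Complex.ofReal_pow, norm_smul, mul_pow, EuclideanSpace.real_norm_sq_eq]
  simp [Matrix.smul_mulVec, dotProduct, neg_div, Finset.mul_sum, sq, mul_assoc, mul_left_comm]

lemma noisyAverage_eq (σ C : ℝ) (s : EuclideanSpace ℝ (Fin n)) (m : ℝ) :
    noisyAverage σ C s m =
      (stdGaussian (EuclideanSpace ℝ (Fin n))).map fun x => m⁻¹ • s + (m⁻¹ * (σ * C)) • x := by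
  rw [noisyAverage, ← mul_pow, multivariateGaussian_smul_one,
    Measure.map_map (by fun_prop) (by fun_prop)]
  congr 1
  ext1 x
  simp [smul_smul]

instance isProbabilityMeasure_noisyAverage (σ C : ℝ) (s : EuclideanSpace ℝ (Fin n)) (m : ℝ) :
    IsProbabilityMeasure (noisyAverage σ C s m) :=
  Measure.isProbabilityMeasure_map (by fun_prop)

lemma volume_map_add_smul (b : EuclideanSpace ℝ (Fin n)) {a : ℝ} (ha : a ≠ 0) :
    (volume : Measure (EuclideanSpace ℝ (Fin n))).map (fun x => b + a • x) =
      ENNReal.ofReal |(a ^ n)⁻¹| • volume := by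
  rw [show (fun x => b + a • x) = (fun x => b + x) ∘ (a • ·) from rfl,
    ← Measure.map_map (by fun_prop) (by fun_prop)]
  have := Measure.map_addHaar_smul (volume : Measure (EuclideanSpace ℝ (Fin n))) ha
  simp only [finrank_euclideanSpace, Fintype.card_fin] at this
  rw [this, Measure.map_smul, map_add_left_eq_self]

/-- The comparison passes through Lebesgue measure, which an invertible affine map only multiplies
by a nonzero constant. -/
lemma noisyAverage_absolutelyContinuous {σ C : ℝ} (hσC : σ * C ≠ 0)
    (s s' : EuclideanSpace ℝ (Fin n)) {m m' : ℝ} (hm : m ≠ 0) (hm' : m' ≠ 0) :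
    noisyAverage σ C s m ≪ noisyAverage σ C s' m' := by
  have h := mul_ne_zero (inv_ne_zero hm) hσC
  have h' := mul_ne_zero (inv_ne_zero hm') hσC
  rw [noisyAverage_eq, noisyAverage_eq]
  refine (stdGaussian_absolutelyContinuous.map (by fun_prop)).trans
    (.trans ?_ (volume_absolutelyContinuous_stdGaussian.map (by fun_prop)))
  rw [volume_map_add_smul _ h, volume_map_add_smul _ h']
  refine Measure.smul_absolutelyContinuous.trans
    (Measure.absolutelyContinuous_smul ?_)
  exact (ENNReal.ofReal_pos.2 (abs_pos.2 (inv_ne_zero (pow_ne_zero n h')))).ne'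

/-- A linear map whose rows are orthonormal and orthogonal to a given vector. -/
lemma exists_map_stdGaussian_eq_stdNormalPow (hn : 1 ≤ n) (d : EuclideanSpace ℝ (Fin n)) :
    ∃ L : EuclideanSpace ℝ (Fin n) →L[ℝ] (Fin (n - 1) → ℝ), L d = 0 ∧
      (stdGaussian (EuclideanSpace ℝ (Fin n))).map L = stdNormalPow (n - 1) := by
  obtain ⟨k, rfl⟩ := Nat.exists_eq_add_of_le' hn
  rw [Nat.add_sub_cancel]
  -- An orthonormal basis whose vector `b 0` spans the line of `d`; the remaining vectors will be
  -- the rows of `L`.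
  obtain ⟨b, r, hb⟩ : ∃ (b : OrthonormalBasis (Fin (k + 1)) ℝ (EuclideanSpace ℝ (Fin (k + 1))))
      (r : ℝ), d = r • b 0 := by
    by_cases hd : d = 0
    · exact ⟨EuclideanSpace.basisFun _ ℝ, 0, by simp [hd]⟩
    · obtain ⟨b, hb⟩ := Orthonormal.exists_orthonormalBasis_extension_of_card_eq (𝕜 := ℝ)
        (E := EuclideanSpace ℝ (Fin (k + 1))) (ι := Fin (k + 1)) (by simp)
        (v := fun _ => ‖d‖⁻¹ • d) (s := {0})
        ⟨fun i => by simp [norm_smul, hd], fun i j hij => (hij (Subsingleton.elim _ _)).elim⟩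
      refine ⟨b, ‖d‖, ?_⟩
      rw [hb 0 rfl, smul_smul, mul_inv_cancel₀ (norm_ne_zero_iff.2 hd), one_smul]
  refine ⟨ContinuousLinearMap.pi fun j => innerSL ℝ (b j.succ), ?_, ?_⟩
  · ext j
    simp [hb, b.inner_eq_ite]
  · rw [stdGaussian_eq_map_pi_orthonormalBasis b, Measure.map_map (by fun_prop)
      (Finset.measurable_sum _ (by fun_prop))]
    -- In the coordinates of `b`, the map drops coordinate `0` of a product measure.
    have e : (ContinuousLinearMap.pi fun j : Fin k => innerSL ℝ (b j.succ)) ∘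
        (fun x : Fin (k + 1) → ℝ => ∑ i, x i • b i) =
        Prod.snd ∘ MeasurableEquiv.piFinSuccAbove (fun _ : Fin (k + 1) => ℝ) 0 := by
      ext x j
      simp [inner_sum, inner_smul_right, b.inner_eq_ite, Fin.tail]
    rw [e, ← Measure.map_map measurable_snd (MeasurableEquiv.measurable _),
      (measurePreserving_piFinSuccAbove _ 0).map_eq, ← Measure.snd, Measure.snd_prod]
    rfl

lemma stdNormalPow_map_smul (N k : ℕ) :
    (stdNormalPow k).map (fun x => ((N : ℝ) / (N + 1)) • x) = shrunkNormalPow N k := by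
  have h := Measure.pi_map_pi (μ := fun _ : Fin k => gaussianReal 0 1)
    (f := fun _ x => ((N : ℝ) / (N + 1)) * x) (fun _ => by fun_prop)
  simp only [gaussianReal_map_const_mul, mul_zero, mul_one] at h
  rw [stdNormalPow, shrunkNormalPow]
  refine h.trans ?_
  congr! 3

/-- Two Gaussian averages with sample sizes `N` and `N + 1` can be processed into the pair of
product distributions by projecting onto the orthogonal complement of the difference of means. -/
lemma exists_map_noisyAverage_eq (hn : 1 ≤ n) {N : ℕ} (hN : N ≠ 0) {q σ C : ℝ} (hq : q ≠ 0)
    (hσC : σ * C ≠ 0) (s s' : EuclideanSpace ℝ (Fin n)) :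
    ∃ T : EuclideanSpace ℝ (Fin n) → (Fin (n - 1) → ℝ), Measurable T ∧
      (noisyAverage σ C s (N * q)).map T = stdNormalPow (n - 1) ∧
      (noisyAverage σ C s' ((N + 1) * q)).map T = shrunkNormalPow N (n - 1) := by
  have hN' : (N : ℝ) ≠ 0 := Nat.cast_ne_zero.2 hN
  have hN1 : (N : ℝ) + 1 ≠ 0 := by positivity
  obtain ⟨hσ, hC⟩ := mul_ne_zero_iff.1 hσC
  -- The killed vector is the difference of the two means, so one centering serves both laws.
  obtain ⟨L, hL, hmap⟩ := exists_map_stdGaussian_eq_stdNormalPow hn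
    ((((N : ℝ) + 1) * q)⁻¹ • s' - ((N : ℝ) * q)⁻¹ • s)
  rw [map_sub, sub_eq_zero] at hL
  -- The factor inverts the first noise scale `σ * C / (N * q)`; applied to the second scale it
  -- leaves `N / (N + 1)`.
  refine ⟨fun y => (N * q / (σ * C)) • (L y - L (((N : ℝ) * q)⁻¹ • s)), by fun_prop, ?_, ?_⟩
  · rw [noisyAverage_eq, Measure.map_map (by fun_prop) (by fun_prop), ← hmap]
    congr 1
    ext x j
    simp only [Function.comp_apply, map_add, add_sub_cancel_left, map_smul L (_ * _) x, smul_smul]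
    rw [show N * q / (σ * C) * ((N * q)⁻¹ * (σ * C)) = 1 by field_simp, one_smul]
  · rw [noisyAverage_eq, Measure.map_map (by fun_prop) (by fun_prop), ← stdNormalPow_map_smul,
      ← hmap, Measure.map_map (by fun_prop) (by fun_prop)]
    congr 1
    ext x j
    simp only [Function.comp_apply, map_add, ← hL, add_sub_cancel_left, map_smul L (_ * _) x,
      smul_smul]
    rw [show N * q / (σ * C) * (((N + 1) * q)⁻¹ * (σ * C)) = (N : ℝ) / (N + 1) by field_simp]

end Gaussian

/-! ### Probabilities of the sampling outcomes -/

section Sampling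

variable {N : ℕ}

lemma batchProb_nonneg {q : ℝ} (hq : 0 ≤ q) (hq1 : q ≤ 1) (B : Finset (Fin N)) :
    0 ≤ batchProb q B :=
  mul_nonneg (pow_nonneg hq _) (pow_nonneg (sub_nonneg.2 hq1) _)

lemma sum_batchProb (q : ℝ) : ∑ B : Finset (Fin N), batchProb q B = 1 := by
  simpa using! Fin.sum_pow_mul_eq_add_pow (n := N) q (1 - q)

lemma sum_outcome (q : ℝ) (F : Finset (Fin N) → Bool → ℝ) :
    ∑ I : Finset (Fin N) × Bool, (batchProb q I.1 * if I.2 then q else 1 - q) * F I.1 I.2 =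
      ∑ B, batchProb q B * ((1 - q) * F B false + q * F B true) := by
  rw [Fintype.sum_prod_type]
  refine Finset.sum_congr rfl fun B _ => ?_
  simp only [Fintype.sum_bool, if_true, Bool.false_eq_true, if_false]
  ring

end Sampling

end EASGM

theorem mainTheorem3 (n N : ℕ) (hn : 1 ≤ n) (hN : 1 ≤ N) (q σ C : ℝ) (hq : 0 < q) (hq1 : q ≤ 1)
    (hσ : 0 < σ) (hC : 0 < C) (g : Fin N → EuclideanSpace ℝ (Fin n))
    (g' : EuclideanSpace ℝ (Fin n)) :
    (∀ t c : ℝ, 0 ≤ t → c ∈ Set.Icc (0 : ℝ) 1 →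
      EASGM.guarantee q σ C g g' (EASGM.totalTypeI q σ C g g' t c) =
        EASGM.totalTypeII q σ C g g' t c) ∧
    ∀ α ∈ Set.Icc (0 : ℝ) 1, EASGM.guarantee q σ C g g' α ≤ EASGM.upperBound n N α := by
  have hσC : σ * C ≠ 0 := (mul_pos hσ hC).ne'
  have hN0 : N ≠ 0 := Nat.one_le_iff_ne_zero.1 hN
  have hm : (N : ℝ) * q ≠ 0 := mul_ne_zero (Nat.cast_ne_zero.2 hN0) hq.ne'
  have hm' : ((N : ℝ) + 1) * q ≠ 0 := mul_ne_zero (by positivity) hq.ne'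
  have hw : ∀ I : Finset (Fin N) × Bool,
      0 ≤ EASGM.batchProb q I.1 * if I.2 then q else 1 - q := fun I =>
    mul_nonneg (EASGM.batchProb_nonneg hq.le hq1 _) (by split_ifs <;> linarith)
  have hw1 : ∑ I : Finset (Fin N) × Bool,
      (EASGM.batchProb q I.1 * if I.2 then q else 1 - q) = 1 := by
    simpa [EASGM.sum_batchProb] using EASGM.sum_outcome (N := N) q fun _ _ => 1
  -- Adding `0` when the last record is not sampled puts both kinds of outcome into one Gaussian
  -- family.
  let S : Finset (Fin N) × Bool → EuclideanSpace ℝ (Fin n) := fun I =>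
    ∑ i ∈ I.1, EASGM.clip C (g i) + if I.2 then EASGM.clip C g' else 0
  let P : Finset (Fin N) × Bool → Measure (EuclideanSpace ℝ (Fin n)) := fun I =>
    EASGM.noisyAverage σ C (∑ i ∈ I.1, EASGM.clip C (g i)) (N * q)
  let Q : Finset (Fin N) × Bool → Measure (EuclideanSpace ℝ (Fin n)) := fun I =>
    EASGM.noisyAverage σ C (S I) ((N + 1) * q)
  have hQ : (fun I : Finset (Fin N) × Bool =>
      if I.2 then EASGM.outD'₂ q σ C g g' I.1 else EASGM.outD'₁ q σ C g I.1) = Q := by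
    ext1 ⟨B, b⟩
    cases b <;> simp [Q, S, EASGM.outD'₁, EASGM.outD'₂]
  have hQ1 : ∀ B, EASGM.outD'₁ q σ C g B = Q (B, false) := fun B => by
    simp [Q, S, EASGM.outD'₁]
  have hf : EASGM.guarantee q σ C g g' = EASGM.tradeOff
      (EASGM.labelledMixture (fun I : Finset (Fin N) × Bool =>
        EASGM.batchProb q I.1 * if I.2 then q else 1 - q) P)
      (EASGM.labelledMixture (fun I => EASGM.batchProb q I.1 * if I.2 then q else 1 - q) Q) := by
    rw [← hQ]; rfl
  have : ∀ I, IsFiniteMeasure (P I) := fun I => by unfold P; infer_instance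
  have : ∀ I, IsFiniteMeasure (Q I) := fun I => by unfold Q; infer_instance
  rw [hf]
  refine ⟨fun t c ht hc => ?_, fun α hα => ?_⟩
  · have h := EASGM.tradeOff_labelledMixture hw
      (fun I => EASGM.noisyAverage_absolutelyContinuous hσC (S I)
        (∑ i ∈ I.1, EASGM.clip C (g i)) hm' hm : ∀ I, Q I ≪ P I) ht hc
    rw [EASGM.sum_outcome q fun B b => EASGM.lrTypeI (P (B, b)) (Q (B, b)) t c,
      EASGM.sum_outcome q fun B b => EASGM.tradeOff (P (B, b)) (Q (B, b))
        (EASGM.lrTypeI (P (B, b)) (Q (B, b)) t c)] at h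
    simp only [EASGM.totalTypeI, EASGM.totalTypeII, hQ1]
    exact h
  · choose T hT hP₀ hQ₀ using fun I => EASGM.exists_map_noisyAverage_eq hn hN0 hq.ne' hσC
      (∑ i ∈ I.1, EASGM.clip C (g i)) (S I)
    exact EASGM.tradeOff_labelledMixture_le hw hw1 hT hP₀ hQ₀ hα.1
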